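/- For complex $q$ with $|q|<1$ put $(q;q)_n=\prod_{i=1}^{n}(1-q^i)$, $(q;q)_\infty=\lim_{n\to\infty}(q;q)_n$, and $\genfrac{[}{]}{0pt}{}{n}{k}_q=\frac{(q;q)_n}{(q;q)_k\,(q;q)_{n-k}}$ if $0\le k\le n$ and $\genfrac{[}{]}{0pt}{}{n}{k}_q=0$ otherwise. Then for every complex $q$ with $|q|<1$ and every integer $m\ge 1$, both series on the right-hand sides below converge and $$\frac{1}{(q;q)_\infty}\sum_{l=0}^{m-1}(-1)^l q^{\frac{l(3l+1)}{2}}\bigl(1-q^{2l+1}\bigr)=1+(-1)^{m-1}\sum_{d=1}^{\infty}\frac{q^{d^2+d+\binom m2}}{(q;q)_{2d}}\,\frac{1-q^m}{1-q^d}\genfrac{[}{]}{0pt}{}{2d}{d+m}_q$$ and $$\frac{1}{(q;q)_\infty}\sum_{l=0}^{m-1}(-1)^l q^{\frac{l(3l-1)}{2}}\bigl(1-q^{4l+2}\bigr)=1+(-1)^{m-1}\sum_{d=1}^{\infty}\frac{q^{d^2+\binom m2}}{(q;q)_{2d}}\,\frac{1-q^m}{1-q^d}\genfrac{[}{]}{0pt}{}{2d}{d+m}_q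 .$$ -/

import Mathlib

open Filter Topology

/-- The finite `q`-shifted factorial `(a;q)_n = (1-a)(1-aq)⋯(1-aq^{n-1})`. -/
def qPoch (a q : ℂ) (n : ℕ) : ℂ :=
  ∏ i ∈ Finset.range n, (1 - a * q ^ i)

/-- The infinite `q`-shifted factorial `(a;q)_∞ = ∏_{i ≥ 0} (1 - a q^i)`, used for `|q| < 1`;
it is the limit of `(a;q)_n` as `n → ∞`, see `tendsto_qPoch`. -/
noncomputable def qPochInf (a q : ℂ) : ℂ :=
  ∏' i : ℕ, (1 - a * q ^ i)

/-- The `q`-binomial coefficient `(q;q)_n / ((q;q)_k (q;q)_{n-k})` for `0 ≤ k ≤ n`,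
and `0` otherwise. -/
noncomputable def qBinom (q : ℂ) (n k : ℕ) : ℂ :=
  if k ≤ n then qPoch q q n / (qPoch q q k * qPoch q q (n - k)) else 0

theorem summable_norm_neg_mul_pow (a : ℂ) {q : ℂ} (hq : ‖q‖ < 1) :
    Summable fun i : ℕ => ‖-(a * q ^ i)‖ := by
  simpa only [norm_neg, norm_mul, norm_pow] using
    (summable_geometric_of_lt_one (norm_nonneg q) hq).mul_left ‖a‖

/-- `(a;q)_∞ = lim_{n → ∞} (a;q)_n` for `|q| < 1`. -/
theorem tendsto_qPoch (a : ℂ) {q : ℂ} (hq : ‖q‖ < 1) :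
    Tendsto (qPoch a q) atTop (𝓝 (qPochInf a q)) := by
  have h := (multipliable_one_add_of_summable
    (summable_norm_neg_mul_pow a hq)).tendsto_prod_tprod_nat
  simp only [← sub_eq_add_neg] at h
  exact h

/-- `(q;q)_∞ ≠ 0` for `|q| < 1`, so that dividing by it is meaningful. -/
theorem qPochInf_self_ne_zero {q : ℂ} (hq : ‖q‖ < 1) : qPochInf q q ≠ 0 := by
  have h := tprod_one_add_ne_zero_of_summable (f := fun i : ℕ => -(q * q ^ i)) (fun i h0 => by
    have h1 : q ^ (i + 1) = 1 := by linear_combination -h0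
    have h2 : ‖q‖ ^ (i + 1) = 1 := by rw [← norm_pow, h1, norm_one]
    have h3 : ‖q‖ ^ (i + 1) < 1 := pow_lt_one₀ (norm_nonneg q) hq (Nat.succ_ne_zero i)
    exact h3.ne h2) (summable_norm_neg_mul_pow q hq)
  simp only [← sub_eq_add_neg] at h
  exact h

/-- The `d`-th term of the first series,
`q^{d²+d+C(m,2)} / (q;q)_{2d} · (1-q^m)/(1-q^d) · [2d choose d+m]_q`, for `d ≥ 1`. -/
noncomputable def termPos (q : ℂ) (m d : ℕ) : ℂ :=
  q ^ (d ^ 2 + d + m.choose 2) / qPoch q q (2 * d) * ((1 - q ^ m) / (1 - q ^ d)) *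
    qBinom q (2 * d) (d + m)

/-- The `d`-th term of the second series,
`q^{d²+C(m,2)} / (q;q)_{2d} · (1-q^m)/(1-q^d) · [2d choose d+m]_q`, for `d ≥ 1`. -/
noncomputable def termNeg (q : ℂ) (m d : ℕ) : ℂ :=
  q ^ (d ^ 2 + m.choose 2) / qPoch q q (2 * d) * ((1 - q ^ m) / (1 - q ^ d)) *
    qBinom q (2 * d) (d + m)

/-! Let S_m be the series for m, with terms `seriesTerm`. Adding the `d`-th terms for m+1 and m
cancels the denominator 1-q^d (`seriesTerm_succ_add`), so S_{m+1} + S_m is a multiple of a Durfee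
rectangle sum missing its d = 0 term. By `hasSum_durfeeTerm` and `hasSum_durfeeTerm_shifted` the
full sum is 1/(q;q)_∞ up to an elementary factor. As S_0 = 0, induction on m yields the alternating
sum; the constant 1 comes from the d = 0 term, nonzero only for m = 0.

The rectangle sum D(a) satisfies D(a) - D(a+1) = -q^(a+1) (D(a+1) - D(a+2)). Its differences thus
never shrink in norm, yet tend to 0, so D is constant, equal to its limit 1/(q;q)_∞. -/

theorem one_sub_pow_ne_zero {q : ℂ} (hq : ‖q‖ < 1) {n : ℕ} (hn : n ≠ 0) : 1 - q ^ n ≠ 0 := by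
  intro h
  have h1 : ‖q ^ n‖ = 1 := by rw [← sub_eq_zero.1 h, norm_one]
  rw [norm_pow] at h1
  exact (pow_lt_one₀ (norm_nonneg q) hq hn).ne h1

theorem qPoch_self_succ (q : ℂ) (n : ℕ) :
    qPoch q q (n + 1) = qPoch q q n * (1 - q ^ (n + 1)) := by
  simp only [qPoch, Finset.prod_range_succ, pow_succ']

theorem qPoch_zero (a q : ℂ) : qPoch a q 0 = 1 := by
  simp [qPoch]

theorem qPoch_self_ne_zero {q : ℂ} (hq : ‖q‖ < 1) (n : ℕ) : qPoch q q n ≠ 0 := by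
  induction n with
  | zero => simp [qPoch_zero]
  | succ n ih =>
    rw [qPoch_self_succ]
    exact mul_ne_zero ih (one_sub_pow_ne_zero hq n.succ_ne_zero)

theorem exists_norm_inv_qPoch_le {q : ℂ} (hq : ‖q‖ < 1) :
    ∃ C : ℝ, ∀ n, ‖(qPoch q q n)⁻¹‖ ≤ C := by
  have h := (tendsto_qPoch q hq).inv₀ (qPochInf_self_ne_zero hq)
  obtain ⟨C, hC⟩ := (Metric.isBounded_range_of_tendsto _ h).exists_norm_le
  exact ⟨C, fun n => hC _ ⟨n, rfl⟩⟩

/-! ### Durfee rectangle sums -/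

/-- The `k`-th term of the Durfee rectangle expansion of `1 / (q;q)_∞`, for rectangles of size
`k × (k + a)`. -/
noncomputable def durfeeTerm (q : ℂ) (a k : ℕ) : ℂ :=
  q ^ (k ^ 2 + a * k) * (qPoch q q k)⁻¹ * (qPoch q q (k + a))⁻¹

/-- Uniformity in `a` is what dominated convergence needs as `a` tends to infinity. -/
theorem exists_norm_durfeeTerm_le {q : ℂ} (hq : ‖q‖ < 1) :
    ∃ C : ℝ, ∀ a k, ‖durfeeTerm q a k‖ ≤ C * ‖q‖ ^ k := by
  obtain ⟨C, hC⟩ := exists_norm_inv_qPoch_le hq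
  have hC0 : 0 ≤ C := (norm_nonneg _).trans (hC 0)
  refine ⟨C * C, fun a k => ?_⟩
  have hpow : ‖q‖ ^ (k ^ 2 + a * k) ≤ ‖q‖ ^ k :=
    pow_le_pow_of_le_one (norm_nonneg q) hq.le (by nlinarith [Nat.le_self_pow two_ne_zero k])
  rw [durfeeTerm, norm_mul, norm_mul, norm_pow]
  calc ‖q‖ ^ (k ^ 2 + a * k) * ‖(qPoch q q k)⁻¹‖ * ‖(qPoch q q (k + a))⁻¹‖
      ≤ ‖q‖ ^ k * C * C := by gcongr <;> apply hC
    _ = C * C * ‖q‖ ^ k := by ring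

theorem summable_durfeeTerm {q : ℂ} (hq : ‖q‖ < 1) (a : ℕ) : Summable (durfeeTerm q a) := by
  obtain ⟨C, hC⟩ := exists_norm_durfeeTerm_le hq
  exact .of_norm_bounded ((summable_geometric_of_lt_one (norm_nonneg q) hq).mul_left C) (hC a)

theorem durfeeTerm_zero_right (q : ℂ) (a : ℕ) : durfeeTerm q a 0 = (qPoch q q a)⁻¹ := by
  simp [durfeeTerm, qPoch_zero]

theorem tendsto_tsum_durfeeTerm {q : ℂ} (hq : ‖q‖ < 1) :
    Tendsto (fun a => ∑' k, durfeeTerm q a k) atTop (𝓝 (qPochInf q q)⁻¹) := by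
  obtain ⟨C, hC⟩ := exists_norm_durfeeTerm_le hq
  obtain ⟨B, hB⟩ := exists_norm_inv_qPoch_le hq
  -- Only the k = 0 term survives, since q^(ak) tends to 0 for k ≥ 1.
  have hlim : ∀ k, Tendsto (fun a => durfeeTerm q a k) atTop
      (𝓝 (if k = 0 then (qPochInf q q)⁻¹ else 0)) := by
    intro k
    rcases eq_or_ne k 0 with rfl | hk
    · simp only [durfeeTerm_zero_right, if_true]
      exact (tendsto_qPoch q hq).inv₀ (qPochInf_self_ne_zero hq)
    · rw [if_neg hk]
      refine squeeze_zero_norm (a := fun a => B * B * ‖q‖ ^ a) (fun a => ?_) ?_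
      · have hB0 : 0 ≤ B := (norm_nonneg _).trans (hB 0)
        have hpow : ‖q‖ ^ (k ^ 2 + a * k) ≤ ‖q‖ ^ a :=
          pow_le_pow_of_le_one (norm_nonneg q) hq.le
            (by nlinarith [Nat.le_mul_of_pos_right a (Nat.pos_of_ne_zero hk)])
        rw [durfeeTerm, norm_mul, norm_mul, norm_pow]
        calc ‖q‖ ^ (k ^ 2 + a * k) * ‖(qPoch q q k)⁻¹‖ * ‖(qPoch q q (k + a))⁻¹‖
            ≤ ‖q‖ ^ a * B * B := by gcongr <;> apply hB
          _ = B * B * ‖q‖ ^ a := by ring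
      · simpa using (tendsto_pow_atTop_nhds_zero_of_lt_one (norm_nonneg q) hq).const_mul (B * B)
  have h := tendsto_tsum_of_dominated_convergence
    ((summable_geometric_of_lt_one (norm_nonneg q) hq).mul_left C) hlim
    (.of_forall fun a k => hC a k)
  simpa using h

theorem durfeeTerm_sub_zero {q : ℂ} (hq : ‖q‖ < 1) (a : ℕ) :
    durfeeTerm q a 0 - durfeeTerm q (a + 1) 0 = -(q ^ (a + 1) * durfeeTerm q (a + 1) 0) := by
  have h1 := qPoch_self_ne_zero hq a
  have h2 := one_sub_pow_ne_zero hq a.succ_ne_zero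
  rw [durfeeTerm_zero_right, durfeeTerm_zero_right, qPoch_self_succ]
  field_simp
  ring

/-- Since (k+1)² + a(k+1) = k² + (a+2)k + (a+1), all four terms share a power of q over (q;q)_{k+1}
(q;q)_{k+a+2}. The index drop from k+1 to k lets the sum over k close up on the full sum for a+2. -/
theorem durfeeTerm_sub_succ {q : ℂ} (hq : ‖q‖ < 1) (a k : ℕ) :
    durfeeTerm q a (k + 1) - durfeeTerm q (a + 1) (k + 1) =
      q ^ (a + 1) * durfeeTerm q (a + 2) k - q ^ (a + 1) * durfeeTerm q (a + 1) (k + 1) := by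
  have h1 := qPoch_self_ne_zero hq k
  have h2 := one_sub_pow_ne_zero hq k.succ_ne_zero
  have h3 := qPoch_self_ne_zero hq (k + a + 1)
  have h4 := one_sub_pow_ne_zero hq (k + a + 1).succ_ne_zero
  simp only [durfeeTerm, show k + 1 + a = k + a + 1 by ring,
    show k + 1 + (a + 1) = k + a + 1 + 1 by ring, show k + (a + 2) = k + a + 1 + 1 by ring,
    qPoch_self_succ q k, qPoch_self_succ q (k + a + 1)]
  simp only [Nat.succ_eq_add_one] at h2 h4
  field_simp
  ring

theorem tsum_durfeeTerm_sub {q : ℂ} (hq : ‖q‖ < 1) (a : ℕ) :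
    ∑' k, durfeeTerm q a k - ∑' k, durfeeTerm q (a + 1) k =
      -q ^ (a + 1) * (∑' k, durfeeTerm q (a + 1) k - ∑' k, durfeeTerm q (a + 2) k) := by
  have hs := summable_durfeeTerm hq
  have hs' : ∀ a, Summable fun k => durfeeTerm q a (k + 1) := fun a =>
    (summable_nat_add_iff 1).2 (hs a)
  have h := congrArg tsum (funext (durfeeTerm_sub_succ hq a))
  rw [(hs' a).tsum_sub (hs' (a + 1)),
    ((hs (a + 2)).mul_left _).tsum_sub ((hs' (a + 1)).mul_left _), tsum_mul_left,
    tsum_mul_left] at h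
  have h0 := durfeeTerm_sub_zero hq a
  rw [(hs a).tsum_eq_zero_add, (hs (a + 1)).tsum_eq_zero_add]
  linear_combination h + h0

theorem tsum_durfeeTerm_eq_succ {q : ℂ} (hq : ‖q‖ < 1) (a : ℕ) :
    ∑' k, durfeeTerm q a k = ∑' k, durfeeTerm q (a + 1) k := by
  set D : ℕ → ℂ := fun a => ∑' k, durfeeTerm q a k with hD
  have hrec : ∀ a, D a - D (a + 1) = -q ^ (a + 1) * (D (a + 1) - D (a + 2)) :=
    tsum_durfeeTerm_sub hq
  have hle : ∀ n, ‖D a - D (a + 1)‖ ≤ ‖D (a + n) - D (a + n + 1)‖ := by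
    intro n
    induction n with
    | zero => simp
    | succ n ih =>
      refine ih.trans ?_
      rw [hrec (a + n), norm_mul, norm_neg, norm_pow]
      exact mul_le_of_le_one_left (norm_nonneg _) (pow_le_one₀ (norm_nonneg q) hq.le)
  have ht := tendsto_tsum_durfeeTerm hq
  have hlim : Tendsto (fun n => ‖D (a + n) - D (a + n + 1)‖) atTop (𝓝 0) := by
    have h1 : Tendsto (fun n => a + n) atTop atTop :=
      tendsto_atTop_mono (fun n => Nat.le_add_left n a) tendsto_id
    have h2 : Tendsto (fun n => a + n + 1) atTop atTop := (tendsto_add_atTop_nat 1).comp h1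
    simpa using ((ht.comp h1).sub (ht.comp h2)).norm
  have h0 : ‖D a - D (a + 1)‖ ≤ 0 := ge_of_tendsto' hlim hle
  exact sub_eq_zero.1 (norm_le_zero_iff.1 h0)

/-- The Durfee rectangle identity. -/
theorem hasSum_durfeeTerm {q : ℂ} (hq : ‖q‖ < 1) (a : ℕ) :
    HasSum (durfeeTerm q a) (qPochInf q q)⁻¹ := by
  have hconst : ∀ n, ∑' k, durfeeTerm q n k = ∑' k, durfeeTerm q 0 k := fun n => by
    induction n with
    | zero => rfl
    | succ n ih => rw [← tsum_durfeeTerm_eq_succ hq, ih]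
  have h := tendsto_tsum_durfeeTerm hq
  simp only [hconst] at h
  rw [← tendsto_nhds_unique tendsto_const_nhds h, ← hconst a]
  exact (summable_durfeeTerm hq a).hasSum

/-- Termwise, 1/(q;q)_{k+b} + q^(k+b+1)/(q;q)_{k+b+1} = 1/(q;q)_{k+b+1}. -/
theorem hasSum_durfeeTerm_shifted {q : ℂ} (hq : ‖q‖ < 1) (b : ℕ) :
    HasSum (fun k => q ^ (k ^ 2 + b * k) * (qPoch q q k)⁻¹ * (qPoch q q (k + b + 1))⁻¹)
      ((1 + q ^ (b + 1)) * (qPochInf q q)⁻¹) := by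
  have h := (hasSum_durfeeTerm hq b).add ((hasSum_durfeeTerm hq (b + 1)).mul_left (q ^ (b + 1)))
  rw [← one_add_mul] at h
  refine h.congr_fun fun k => ?_
  have h1 := qPoch_self_ne_zero hq k
  have h2 := qPoch_self_ne_zero hq (k + b)
  have h3 := one_sub_pow_ne_zero hq (k + b).succ_ne_zero
  simp only [Nat.succ_eq_add_one] at h3
  simp only [durfeeTerm, ← add_assoc, qPoch_self_succ q (k + b)]
  field_simp
  ring

/-! ### Pairing consecutive series -/

/-- The common form of the terms of the two series: `e = 1` gives `termPos`, `e = 0` gives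
`termNeg`. -/
noncomputable def seriesTerm (q : ℂ) (e m d : ℕ) : ℂ :=
  q ^ (d ^ 2 + e * d + m.choose 2) / qPoch q q (2 * d) * ((1 - q ^ m) / (1 - q ^ d)) *
    qBinom q (2 * d) (d + m)

theorem seriesTerm_of_lt (q : ℂ) (e : ℕ) {m d : ℕ} (h : d < m) : seriesTerm q e m d = 0 := by
  simp [seriesTerm, qBinom, show ¬ d + m ≤ 2 * d by omega]

theorem seriesTerm_add {q : ℂ} (hq : ‖q‖ < 1) (e m k : ℕ) :
    seriesTerm q e m (m + k) = q ^ ((m + k) ^ 2 + e * (m + k) + m.choose 2) *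
      ((1 - q ^ m) / (1 - q ^ (m + k))) * (qPoch q q (2 * m + k))⁻¹ * (qPoch q q k)⁻¹ := by
  have h1 := qPoch_self_ne_zero hq (2 * (m + k))
  rw [seriesTerm, qBinom, if_pos (by omega), show m + k + m = 2 * m + k by ring,
    show 2 * (m + k) - (2 * m + k) = k by omega]
  field_simp

/-- The summand left over when the series for `m + 1` and `m` are added. -/
noncomputable def pairTerm (q : ℂ) (e m d : ℕ) : ℂ :=
  if m ≤ d then q ^ (d ^ 2 + e * d) * (qPoch q q (d - m))⁻¹ * (qPoch q q (d + m + 1))⁻¹ else 0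

/-- For d > m this reduces to q^m (1-q^(m+1)) (1-q^(d-m)) + (1-q^m) (1-q^(d+m+1)) = (1-q^d)
(1-q^(2m+1)). -/
theorem seriesTerm_succ_add {q : ℂ} (hq : ‖q‖ < 1) (e m : ℕ) {d : ℕ} (hd : d ≠ 0) :
    seriesTerm q e (m + 1) d + seriesTerm q e m d =
      (1 - q ^ (2 * m + 1)) * q ^ m.choose 2 * pairTerm q e m d := by
  rcases lt_trichotomy d m with h | rfl | h
  · rw [seriesTerm_of_lt q e h, seriesTerm_of_lt q e (h.trans m.lt_succ_self), pairTerm,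
      if_neg h.not_ge]
    simp
  · have h := seriesTerm_add hq e d 0
    rw [add_zero, add_zero] at h
    have h1 := one_sub_pow_ne_zero hq hd
    have h2 := qPoch_self_ne_zero hq (2 * d)
    have h3 := one_sub_pow_ne_zero hq (2 * d).succ_ne_zero
    simp only [Nat.succ_eq_add_one] at h3
    rw [seriesTerm_of_lt q e d.lt_succ_self, h, pairTerm, if_pos le_rfl, Nat.sub_self,
      show d + d + 1 = 2 * d + 1 by ring, qPoch_self_succ, qPoch_zero, pow_add]
    field_simp
    ring
  · obtain ⟨k, rfl⟩ := Nat.exists_eq_add_of_lt h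
    have h1 := one_sub_pow_ne_zero hq hd
    have h2 := qPoch_self_ne_zero hq (2 * m + k + 1)
    have h3 := one_sub_pow_ne_zero hq (2 * m + k + 1).succ_ne_zero
    have h4 := qPoch_self_ne_zero hq k
    have h5 := one_sub_pow_ne_zero hq k.succ_ne_zero
    simp only [Nat.succ_eq_add_one] at h3 h5
    have e1 := seriesTerm_add hq e (m + 1) k
    have e2 := seriesTerm_add hq e m (k + 1)
    rw [show m + 1 + k = m + k + 1 by ring, show 2 * (m + 1) + k = 2 * m + k + 1 + 1 by ring,
      show (m + 1).choose 2 = m + m.choose 2 by rw [Nat.choose_succ_succ' m 1, Nat.choose_one_right],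
      qPoch_self_succ, ← add_assoc, pow_add, pow_add q _ m] at e1
    rw [← add_assoc, ← add_assoc, qPoch_self_succ q k, pow_add] at e2
    rw [e1, e2, pairTerm, if_pos h.le, show m + k + 1 - m = k + 1 by omega,
      show m + k + 1 + m + 1 = 2 * m + k + 1 + 1 by ring, qPoch_self_succ q k,
      qPoch_self_succ q (2 * m + k + 1)]
    field_simp
    ring

theorem hasSum_pairTerm_of_hasSum {q : ℂ} {e m : ℕ} {s : ℂ}
    (h : HasSum (fun k => q ^ (k ^ 2 + (2 * m + e) * k) * (qPoch q q k)⁻¹ *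
      (qPoch q q (k + 2 * m + 1))⁻¹) s) :
    HasSum (pairTerm q e m) (q ^ (m ^ 2 + e * m) * s) := by
  rw [← hasSum_nat_add_iff' m, Finset.sum_eq_zero, sub_zero]
  · refine (h.mul_left (q ^ (m ^ 2 + e * m))).congr_fun fun k => ?_
    rw [pairTerm, if_pos (by omega), Nat.add_sub_cancel, show k + m + m + 1 = k + 2 * m + 1 by ring]
    ring
  · intro i hi
    rw [pairTerm, if_neg (by simpa using hi)]

theorem hasSum_pairTerm_one {q : ℂ} (hq : ‖q‖ < 1) (m : ℕ) :
    HasSum (pairTerm q 1 m) (q ^ (m ^ 2 + m) * (qPochInf q q)⁻¹) := by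
  simpa using hasSum_pairTerm_of_hasSum (e := 1) (hasSum_durfeeTerm hq (2 * m + 1))

theorem hasSum_pairTerm_zero {q : ℂ} (hq : ‖q‖ < 1) (m : ℕ) :
    HasSum (pairTerm q 0 m) (q ^ m ^ 2 * ((1 + q ^ (2 * m + 1)) * (qPochInf q q)⁻¹)) := by
  simpa using hasSum_pairTerm_of_hasSum (e := 0) (hasSum_durfeeTerm_shifted hq (2 * m))

theorem hasSum_seriesTerm {q : ℂ} (hq : ‖q‖ < 1) {e : ℕ} {s : ℕ → ℂ}
    (hs : ∀ m, HasSum (pairTerm q e m) (s m)) (m : ℕ) :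
    HasSum (fun d => seriesTerm q e (m + 1) (d + 1))
      ((-1) ^ m * (∑ l ∈ Finset.range (m + 1),
        (-1) ^ l * ((1 - q ^ (2 * l + 1)) * q ^ l.choose 2 * s l) - 1)) := by
  have hstep : ∀ m, HasSum
      (fun d => seriesTerm q e (m + 1) (d + 1) + seriesTerm q e m (d + 1))
      ((1 - q ^ (2 * m + 1)) * q ^ m.choose 2 * (s m - pairTerm q e m 0)) := by
    intro m
    have h := (hasSum_nat_add_iff' 1).2 (hs m)
    rw [Finset.sum_range_one] at h
    exact (h.mul_left ((1 - q ^ (2 * m + 1)) * q ^ m.choose 2)).congr_fun fun d =>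
      seriesTerm_succ_add hq e m d.succ_ne_zero
  induction m with
  | zero =>
    have h1 : 1 - q ≠ 0 := by simpa using one_sub_pow_ne_zero hq one_ne_zero
    have h := hstep 0
    -- The factor 1 - q^0 kills the whole series for m = 0.
    have h0 : ∀ d, seriesTerm q e 0 d = 0 := fun d => by simp [seriesTerm]
    simp only [h0, add_zero] at h
    convert h using 1
    -- Here the omitted d = 0 term is 1/(1-q); multiplied by 1-q it gives the -1.
    simp [pairTerm, qPoch, mul_sub, h1]
  | succ m ih =>
    have h := (hstep (m + 1)).sub ih
    simp only [add_sub_cancel_right] at h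
    convert h using 1
    · rfl
    rw [Finset.sum_range_succ _ (m + 1), show pairTerm q e (m + 1) 0 = 0 by simp [pairTerm]]
    have hsign : (-1 : ℂ) ^ m * (-1) ^ m = 1 := by rw [← mul_pow]; simp
    rw [pow_succ]
    linear_combination ((1 - q ^ (2 * (m + 1) + 1)) * q ^ (m + 1).choose 2 * s (m + 1)) * hsign

theorem corollary1p3 (q : ℂ) (hq : ‖q‖ < 1) (m : ℕ) (hm : 1 ≤ m) :
    (Summable (fun d : ℕ => termPos q m (d + 1)) ∧
      1 / qPochInf q q *
          ∑ l ∈ Finset.range m,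
            (-1 : ℂ) ^ l * q ^ (l * (3 * l + 1) / 2) * (1 - q ^ (2 * l + 1)) =
        1 + (-1 : ℂ) ^ (m - 1) * ∑' d : ℕ, termPos q m (d + 1)) ∧
    (Summable (fun d : ℕ => termNeg q m (d + 1)) ∧
      1 / qPochInf q q *
          ∑ l ∈ Finset.range m,
            (-1 : ℂ) ^ l * q ^ (l * (3 * l - 1) / 2) * (1 - q ^ (4 * l + 2)) =
        1 + (-1 : ℂ) ^ (m - 1) * ∑' d : ℕ, termNeg q m (d + 1)) := by
  obtain ⟨m, rfl⟩ := Nat.exists_eq_add_of_le' hm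
  have hpos := hasSum_seriesTerm hq (hasSum_pairTerm_one hq) m
  have hneg := hasSum_seriesTerm hq (hasSum_pairTerm_zero hq) m
  have epos : ∀ d, seriesTerm q 1 (m + 1) d = termPos q (m + 1) d := fun d => by
    simp [seriesTerm, termPos]
  have eneg : ∀ d, seriesTerm q 0 (m + 1) d = termNeg q (m + 1) d := fun d => by
    simp [seriesTerm, termNeg]
  simp only [epos] at hpos
  simp only [eneg] at hneg
  have hsign : (-1 : ℂ) ^ m * (-1) ^ m = 1 := by rw [← mul_pow]; simp
  have hchoose : ∀ l : ℕ, l.choose 2 * 2 + l = l * l := fun l => by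
    induction l with
    | zero => rfl
    | succ l ih => rw [Nat.choose_succ_succ' l 1, Nat.choose_one_right]; linarith
  refine ⟨⟨hpos.summable, ?_⟩, ⟨hneg.summable, ?_⟩⟩
  · rw [hpos.tsum_eq, Nat.add_sub_cancel, ← mul_assoc, hsign, one_mul, add_sub_cancel,
      Finset.mul_sum]
    refine Finset.sum_congr rfl fun l _ => ?_
    have hexp : l * (3 * l + 1) / 2 = l.choose 2 + (l ^ 2 + l) :=
      Nat.div_eq_of_eq_mul_left two_pos (by nlinarith [hchoose l])
    rw [hexp, pow_add q (l.choose 2)]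
    ring
  · rw [hneg.tsum_eq, Nat.add_sub_cancel, ← mul_assoc, hsign, one_mul, add_sub_cancel,
      Finset.mul_sum]
    refine Finset.sum_congr rfl fun l _ => ?_
    have hexp : l * (3 * l - 1) / 2 = l.choose 2 + l ^ 2 := by
      refine Nat.div_eq_of_eq_mul_left two_pos ?_
      -- At l = 0 the subtraction 3l - 1 truncates, harmlessly because of the factor l.
      rcases l with _ | l
      · rfl
      · rw [show 3 * (l + 1) - 1 = 3 * l + 2 by omega]
        nlinarith [hchoose (l + 1)]
    rw [hexp, pow_add q (l.choose 2)]
    -- The factor 1 + q^(2l+1) from the shifted sum turns 1 - q^(2l+1) into 1 - q^(4l+2).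
    ring
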